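/- Let $(\Omega,\mathcal F,(\mathcal F_t)_{t\ge0},\mathbb P)$ be a filtered probability space. Let $\ell=(\ell(t))_{t\ge0}$ be a non-negative continuous semimartingale whose initial value $\ell(0)$ is deterministic, and put $\bar\ell_t:=\sup_{s\in[0,t]}\ell(s)$. Let $M=(M(t))_{t\ge0}$ be a continuous martingale with $M(0)=0$ and let $c\ge 0$ be a constant such that $$\mathrm d\ell(t)\le \mathrm dM(t)+c\,\bar\ell_t\,\mathrm dt,$$ that is, almost surely $\ell(t)-\ell(s)\le M(t)-M(s)+c\int_s^t\bar\ell_r\,\mathrm dr$ for all $0\le s\le t$. Then, for all $T>0$ and $\varepsilon\ge 0$, $$\mathbb E\exp\Big[\frac{\varepsilon}{T e^{1+cT}}\int_0^T\bar\ell_t\,\mathrm dt\Big]\le e^{\varepsilon \ell(0)+1}\big(\mathbb E\, e^{2\varepsilon^2\langle M\rangle(T)}\big)^{1/2},$$ where $\langle M\rangle$ is the quadratic variation process of $M$, and both expectations are taken in $[0,\infty]$. -/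

import Mathlib

open MeasureTheory ProbabilityTheory Filter
open scoped NNReal ENNReal

/-- `N` is a continuous local martingale null at `0`: it is adapted, almost all its paths are
continuous and start at `0`, and it is localized by stopping times to genuine martingales. -/
structure IsContinuousLocalMartingale {Ω : Type*} {mΩ : MeasurableSpace Ω}
    (N : ℝ≥0 → Ω → ℝ) (𝓕 : Filtration ℝ≥0 mΩ) (μ : Measure Ω) : Prop where
  adapted : StronglyAdapted 𝓕 N
  continuous : ∀ᵐ ω ∂μ, Continuous fun t => N t ω
  zero : ∀ᵐ ω ∂μ, N 0 ω = 0
  locally_martingale : Locally (fun Y => Martingale Y 𝓕 μ) 𝓕 N μ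

/-- `A` is a continuous adapted process of (locally) finite variation, null at `0`. -/
structure IsContinuousFiniteVariation {Ω : Type*} {mΩ : MeasurableSpace Ω}
    (A : ℝ≥0 → Ω → ℝ) (𝓕 : Filtration ℝ≥0 mΩ) (μ : Measure Ω) : Prop where
  adapted : StronglyAdapted 𝓕 A
  continuous : ∀ᵐ ω ∂μ, Continuous fun t => A t ω
  zero : ∀ᵐ ω ∂μ, A 0 ω = 0
  finite_variation : ∀ᵐ ω ∂μ, LocallyBoundedVariationOn (fun t => A t ω) Set.univ

/-- `X` is a continuous semimartingale: an adapted process with `X = X₀ + N + A`, where `N` is a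
continuous local martingale and `A` a continuous adapted process of finite variation. -/
def IsContinuousSemimartingale {Ω : Type*} {mΩ : MeasurableSpace Ω}
    (X : ℝ≥0 → Ω → ℝ) (𝓕 : Filtration ℝ≥0 mΩ) (μ : Measure Ω) : Prop :=
  StronglyAdapted 𝓕 X ∧
    ∃ N A : ℝ≥0 → Ω → ℝ, IsContinuousLocalMartingale N 𝓕 μ ∧ IsContinuousFiniteVariation A 𝓕 μ ∧
      ∀ᵐ ω ∂μ, ∀ t, X t ω = X 0 ω + N t ω + A t ω

/-- The running supremum `sup_{s ∈ [0,t]} X(s)`. -/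
noncomputable def runningSup {Ω : Type*} (X : ℝ≥0 → Ω → ℝ) (t : ℝ≥0) (ω : Ω) : ℝ :=
  ⨆ s : Set.Icc (0 : ℝ≥0) t, X s ω

/-- The sum of the squared increments of `X` along the `n`-th dyadic partition of `[0,t]`. -/
noncomputable def sqIncrements {Ω : Type*} (X : ℝ≥0 → Ω → ℝ) (t : ℝ≥0) (n : ℕ) (ω : Ω) : ℝ :=
  ∑ k ∈ Finset.range (2 ^ n),
    (X (t * ((k + 1 : ℕ) : ℝ≥0) / 2 ^ n) ω - X (t * (k : ℝ≥0) / 2 ^ n) ω) ^ 2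

open Classical in
/-- The quadratic variation `⟨X⟩(t)`: the limit in probability of the sums of squared increments
over the dyadic partitions of `[0,t]`. (The limit always exists and is finite when `X` is a
continuous martingale; for a process without such a limit the value is `∞`.) -/
noncomputable def quadVar {Ω : Type*} {mΩ : MeasurableSpace Ω}
    (X : ℝ≥0 → Ω → ℝ) (μ : Measure Ω) (t : ℝ≥0) (ω : Ω) : ℝ≥0∞ :=
  if h : ∃ V : Ω → ℝ, TendstoInMeasure μ (sqIncrements X t) atTop V
  then ENNReal.ofReal (h.choose ω) else ∞

/-- The quadratic variation is almost surely equal to any limit in probability of the sums of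
squared increments, so it does not depend on choices. -/
theorem quadVar_ae_eq {Ω : Type*} {mΩ : MeasurableSpace Ω}
    (X : ℝ≥0 → Ω → ℝ) (μ : Measure Ω) (t : ℝ≥0) (V : Ω → ℝ)
    (hV : TendstoInMeasure μ (sqIncrements X t) atTop V) :
    ∀ᵐ ω ∂μ, quadVar X μ t ω = ENNReal.ofReal (V ω) := by
  have h : ∃ V : Ω → ℝ, TendstoInMeasure μ (sqIncrements X t) atTop V := ⟨V, hV⟩
  filter_upwards [tendstoInMeasure_ae_unique h.choose_spec hV] with ω hω
  simp only [quadVar, dif_pos h, hω]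

/-!
The two ingredients are a pathwise Gronwall inequality and an exponential maximal inequality for
continuous martingales.

If `l t ≤ l 0 + M t + c ∫₀ᵗ sup l`, Gronwall's inequality gives
`∫₀ᵀ sup l ≤ T exp (c T) (l 0 + sup M)` for the supremum of `M` over `[0, T]`
(`integral_runningSup_le`). So it is enough to bound the exponential moment of `(ε / e) sup M`. The
factor `1 / e` gained here leaves room for constants that are not sharp, and neither Itô's formula
nor optional stopping in continuous time is used.

For a martingale in discrete time, the elementary inequality `exp (y - y²) ≤ 1 + y`, valid for
`y ≥ -1/2`, compares `exp (X - ∑ (ΔX)²)` with the discrete stochastic exponential `∏ (1 + ΔX)`.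
Running this product until `X` reaches a level `x` or makes a downward step larger than `1/2` yields
a pathwise domination by a martingale transform (`exp_passage_le`). On taking expectations, only the
downward steps larger than `1/2` contribute an error (`lintegral_exp_passage_le`). Along dyadic grids
this error vanishes because the paths are uniformly continuous and the overshoots are bounded by the
submartingale `|X|`, so Fatou's lemma gives
`E [exp (-V); sup M > x] ≤ exp (-x)`, with `V` the quadratic variation (`setLIntegral_exp_neg_le`).

Integrating this tail bound gives `E exp (2/3 sup M - V) ≤ 3`, and the Cauchy-Schwarz inequality
turns it into `E exp (sup M / 3) ≤ e (E exp V) ^ (1/2)` (`lintegral_exp_dyadicSup_le`). Applied to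
`κ M` with `κ = 3 ε / e`, for which `κ² ≤ 2 ε²`, this is the required bound.
-/

/-! ### A pathwise exponential inequality -/

lemma exp_sub_sq_le_one_add {y : ℝ} (hy : -(1 / 2) ≤ y) : Real.exp (y - y ^ 2) ≤ 1 + y := by
  have key : 1 ≤ (1 + y) * Real.exp (y ^ 2 - y) := by
    rcases le_total 0 y with h | h
    · have := Real.add_one_le_exp (y ^ 2 - y)
      nlinarith [pow_nonneg h 3]
    · have h0 : 0 ≤ y ^ 2 - y := by nlinarith
      have := Real.quadratic_le_exp_of_nonneg h0
      have h1 : 1 ≤ (1 + y) * (1 + (y ^ 2 - y) + (y ^ 2 - y) ^ 2 / 2) := by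
        have h2 : 0 ≤ (1 + y) * (1 - y) ^ 2 / 2 + y := by
          nlinarith [mul_nonneg (by linarith : (0:ℝ) ≤ y + 1 / 2) (neg_nonneg.2 h),
            mul_nonneg (mul_nonneg (by linarith : (0:ℝ) ≤ y + 1 / 2) (neg_nonneg.2 h))
              (neg_nonneg.2 h)]
        nlinarith [mul_nonneg (sq_nonneg y) h2]
      exact h1.trans (mul_le_mul_of_nonneg_left this (by linarith))
  have e : Real.exp (y - y ^ 2) * Real.exp (y ^ 2 - y) = 1 := by
    rw [← Real.exp_add]; simp
  have p := Real.exp_pos (y ^ 2 - y)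
  by_contra! hlt
  nlinarith

/-- Up to time `k` the sequence `u` has stayed below the level `x` and has had no increment below
`-1/2`. -/
def Running (x : ℝ) (u : ℕ → ℝ) (k : ℕ) : Prop :=
  (∀ j ≤ k, u j < x) ∧ ∀ j < k, -(1 / 2) ≤ u (j + 1) - u j

open Classical in
/-- The discrete stochastic exponential `∏ (1 + Δu)`, killed as soon as `u` is no longer
`Running`. -/
noncomputable def killedExponential (x : ℝ) (u : ℕ → ℝ) (k : ℕ) : ℝ :=
  if Running x u k then ∏ j ∈ Finset.range k, (1 + (u (j + 1) - u j)) else 0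

/-- The sequence `u` is stopped at step `k` because its next increment is below `-1/2`. -/
def BadStep (x : ℝ) (u : ℕ → ℝ) (k : ℕ) : Prop :=
  Running x u k ∧ u (k + 1) - u k < -(1 / 2)

/-- Within its first `n` steps, `u` reaches the level `x`, and none of these steps has an increment
below `-1/2`. -/
def GoodPassage (x : ℝ) (u : ℕ → ℝ) (n : ℕ) : Prop :=
  (∀ j < n, -(1 / 2) ≤ u (j + 1) - u j) ∧ ∃ j ≤ n, x ≤ u j

lemma Running.mono {x : ℝ} {u : ℕ → ℝ} {k n : ℕ} (h : Running x u n) (hkn : k ≤ n) :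
    Running x u k :=
  ⟨fun j hj => h.1 j (hj.trans hkn), fun j hj => h.2 j (hj.trans_le hkn)⟩

lemma prod_one_add_nonneg {u : ℕ → ℝ} {k : ℕ} (h : ∀ j < k, -(1 / 2) ≤ u (j + 1) - u j) :
    0 ≤ ∏ j ∈ Finset.range k, (1 + (u (j + 1) - u j)) :=
  Finset.prod_nonneg fun j hj => by linarith [h j (Finset.mem_range.1 hj)]

lemma prod_one_add_le_exp {u : ℕ → ℝ} {k : ℕ} (h : ∀ j < k, -(1 / 2) ≤ u (j + 1) - u j) :
    ∏ j ∈ Finset.range k, (1 + (u (j + 1) - u j)) ≤ Real.exp (u k - u 0) := by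
  rw [← Finset.sum_range_sub, Real.exp_sum]
  refine Finset.prod_le_prod (fun j hj => by linarith [h j (Finset.mem_range.1 hj)]) fun j _ => ?_
  linarith [Real.add_one_le_exp (u (j + 1) - u j)]

lemma exp_le_prod_one_add {u : ℕ → ℝ} {k : ℕ} (h : ∀ j < k, -(1 / 2) ≤ u (j + 1) - u j) :
    Real.exp (u k - u 0 - ∑ j ∈ Finset.range k, (u (j + 1) - u j) ^ 2) ≤
      ∏ j ∈ Finset.range k, (1 + (u (j + 1) - u j)) := by
  rw [← Finset.sum_range_sub, ← Finset.sum_sub_distrib, Real.exp_sum]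
  exact Finset.prod_le_prod (fun _ _ => (Real.exp_pos _).le) fun j hj =>
    exp_sub_sq_le_one_add (h j (Finset.mem_range.1 hj))

lemma killedExponential_nonneg (x : ℝ) (u : ℕ → ℝ) (k : ℕ) : 0 ≤ killedExponential x u k := by
  unfold killedExponential
  split_ifs with h
  · exact prod_one_add_nonneg h.2
  · exact le_rfl

lemma killedExponential_le {x : ℝ} {u : ℕ → ℝ} (h0 : u 0 = 0) (k : ℕ) :
    killedExponential x u k ≤ Real.exp x := by
  unfold killedExponential
  split_ifs with h
  · refine (prod_one_add_le_exp h.2).trans (Real.exp_le_exp.2 ?_)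
    linarith [h.1 k le_rfl]
  · exact (Real.exp_pos _).le

open Classical in
/-- On a good passage of the level `x`, the quantity `exp (x - ∑ (Δu)²)` is dominated by `1` plus a
martingale transform of `u`, up to a correction that is only charged when an increment falls below
`-1/2`. -/
lemma exp_passage_le {x : ℝ} (hx : 0 < x) {u : ℕ → ℝ} (h0 : u 0 = 0) (n : ℕ) :
    (if GoodPassage x u n then
      Real.exp (x - ∑ j ∈ Finset.range n, (u (j + 1) - u j) ^ 2) else 0) ≤
    1 + ∑ k ∈ Finset.range n, killedExponential x u k * (u (k + 1) - u k) +
      Real.exp x * ∑ k ∈ Finset.range n, (if BadStep x u k then x + |u (k + 1)| else 0) := by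
  -- As long as `u` is running, the right-hand side moreover dominates the product `∏ (1 + Δu)`.
  suffices H : (Running x u n → ∏ j ∈ Finset.range n, (1 + (u (j + 1) - u j)) ≤
      1 + ∑ k ∈ Finset.range n, killedExponential x u k * (u (k + 1) - u k) +
      Real.exp x * ∑ k ∈ Finset.range n, (if BadStep x u k then x + |u (k + 1)| else 0)) ∧
    (if GoodPassage x u n then
      Real.exp (x - ∑ j ∈ Finset.range n, (u (j + 1) - u j) ^ 2) else 0) ≤
    1 + ∑ k ∈ Finset.range n, killedExponential x u k * (u (k + 1) - u k) +
      Real.exp x * ∑ k ∈ Finset.range n, (if BadStep x u k then x + |u (k + 1)| else 0) from H.2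
  induction n with
  | zero =>
    refine ⟨fun _ => by simp, ?_⟩
    have : ¬ GoodPassage x u 0 := by
      rintro ⟨-, j, hj, hxj⟩
      obtain rfl : j = 0 := by omega
      linarith
    simp [this]
  | succ n ih =>
    obtain ⟨ih1, ih2⟩ := ih
    set R := 1 + ∑ k ∈ Finset.range n, killedExponential x u k * (u (k + 1) - u k) +
      Real.exp x * ∑ k ∈ Finset.range n, (if BadStep x u k then x + |u (k + 1)| else 0) with hR
    have hsucc : 1 + ∑ k ∈ Finset.range (n + 1), killedExponential x u k * (u (k + 1) - u k) +
        Real.exp x * ∑ k ∈ Finset.range (n + 1), (if BadStep x u k then x + |u (k + 1)| else 0) =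
        R + killedExponential x u n * (u (n + 1) - u n) +
          Real.exp x * (if BadStep x u n then x + |u (n + 1)| else 0) := by
      rw [hR, Finset.sum_range_succ, Finset.sum_range_succ]; ring
    rw [hsucc]
    by_cases hn : Running x u n
    · have hP := ih1 hn
      have hP0 := prod_one_add_nonneg hn.2
      have hPx : ∏ j ∈ Finset.range n, (1 + (u (j + 1) - u j)) ≤ Real.exp x := by
        simpa [killedExponential, hn] using killedExponential_le (x := x) h0 n
      have hK : killedExponential x u n = ∏ j ∈ Finset.range n, (1 + (u (j + 1) - u j)) := by
        simp [killedExponential, hn]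
      rw [hK]
      by_cases hd : u (n + 1) - u n < -(1 / 2)
      · have hb : BadStep x u n := ⟨hn, hd⟩
        have hr : ¬ Running x u (n + 1) := fun h => by linarith [h.2 n (by omega)]
        have hg : ¬ GoodPassage x u (n + 1) := fun h => by linarith [h.1 n (by omega)]
        simp only [hr, hb, hg, if_true, if_false, false_imp_iff, true_and]
        have h1 : -(u (n + 1) - u n) ≤ x + |u (n + 1)| := by
          linarith [hn.1 n le_rfl, neg_abs_le (u (n + 1))]
        have h2 : 0 ≤ x + |u (n + 1)| := by positivity
        nlinarith [mul_le_mul_of_nonneg_left h1 hP0, mul_le_mul_of_nonneg_right hPx h2]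
      · have hb : ¬ BadStep x u n := fun h => hd h.2
        push Not at hd
        have hall : ∀ j < n + 1, -(1 / 2) ≤ u (j + 1) - u j := by
          intro j hj
          rcases Nat.lt_succ_iff_lt_or_eq.1 hj with h | rfl
          · exact hn.2 j h
          · exact hd
        have hprod : ∏ j ∈ Finset.range (n + 1), (1 + (u (j + 1) - u j)) ≤
            R + (∏ j ∈ Finset.range n, (1 + (u (j + 1) - u j))) * (u (n + 1) - u n) := by
          rw [Finset.prod_range_succ]; linarith
        simp only [hb, if_false, mul_zero, add_zero]
        refine ⟨fun _ => hprod, le_trans ?_ hprod⟩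
        split_ifs with hg
        · obtain ⟨j, hj, hxj⟩ := hg.2
          have hj' : j = n + 1 := by
            by_contra hne
            exact absurd (hn.1 j (by omega)) (not_lt.2 hxj)
          subst hj'
          refine le_trans (Real.exp_le_exp.2 ?_) (exp_le_prod_one_add hall)
          linarith
        · exact prod_one_add_nonneg hall
    · have hr : ¬ Running x u (n + 1) := fun h => hn (h.mono (Nat.le_succ n))
      have hb : ¬ BadStep x u n := fun h => hn h.1
      have hK : killedExponential x u n = 0 := by simp [killedExponential, hn]
      simp only [hr, hb, hK, false_imp_iff, true_and, if_false, zero_mul, mul_zero, add_zero]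
      refine le_trans ?_ ih2
      by_cases hg : GoodPassage x u (n + 1)
      · have hg' : GoodPassage x u n := by
          refine ⟨fun j hj => hg.1 j (by omega), ?_⟩
          by_contra! h
          exact hn ⟨h, fun j hj => hg.1 j (by omega)⟩
        simp only [hg, hg', if_true]
        rw [Finset.sum_range_succ]
        exact Real.exp_le_exp.2 (by linarith [sq_nonneg (u (n + 1) - u n)])
      · simp only [hg, if_false]
        split_ifs
        · exact (Real.exp_pos _).le
        · exact le_rfl

/-! ### Discrete-time martingales -/

section Discrete

variable {Ω : Type*} {mΩ : MeasurableSpace Ω} {μ : Measure Ω} {𝒢 : Filtration ℕ mΩ}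
  {X : ℕ → Ω → ℝ}

lemma measurable_of_le (hX : StronglyAdapted 𝒢 X) {j k : ℕ} (hjk : j ≤ k) :
    Measurable[𝒢 k] (X j) :=
  ((hX j).mono (𝒢.mono hjk)).measurable

lemma measurableSet_running (hX : StronglyAdapted 𝒢 X) (x : ℝ) (k : ℕ) :
    MeasurableSet[𝒢 k] {ω | Running x (fun j => X j ω) k} := by
  simp only [Running, Set.ofPred_and, Set.ofPred_forall]
  refine MeasurableSet.inter (MeasurableSet.iInter fun j => MeasurableSet.iInter fun hj => ?_)
    (MeasurableSet.iInter fun j => MeasurableSet.iInter fun hj => ?_)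
  · exact measurableSet_lt (measurable_of_le hX hj) measurable_const
  · exact measurableSet_le measurable_const
      ((measurable_of_le hX hj).sub (measurable_of_le hX hj.le))

lemma measurableSet_badStep (hX : StronglyAdapted 𝒢 X) (x : ℝ) (k : ℕ) :
    MeasurableSet[𝒢 (k + 1)] {ω | BadStep x (fun j => X j ω) k} := by
  simp only [BadStep, Set.ofPred_and]
  exact (𝒢.mono (Nat.le_succ k) _ (measurableSet_running hX x k)).inter (measurableSet_lt
    ((measurable_of_le hX le_rfl).sub (measurable_of_le hX (Nat.le_succ k))) measurable_const)

lemma stronglyMeasurable_killedExponential (hX : StronglyAdapted 𝒢 X) (x : ℝ) (k : ℕ) :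
    StronglyMeasurable[𝒢 k] fun ω => killedExponential x (fun j => X j ω) k := by
  refine Measurable.stronglyMeasurable ?_
  unfold killedExponential
  refine Measurable.ite (measurableSet_running hX x k) ?_ measurable_const
  refine Finset.measurable_prod _ fun j hj => measurable_const.add ?_
  have hj := Finset.mem_range.1 hj
  exact (measurable_of_le hX hj).sub (measurable_of_le hX hj.le)

lemma measurableSet_goodPassage (hX : ∀ k, Measurable (X k)) (x : ℝ) (n : ℕ) :
    MeasurableSet {ω | GoodPassage x (fun j => X j ω) n} := by
  simp only [GoodPassage, Set.ofPred_and, Set.ofPred_forall, Set.ofPred_exists]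
  refine MeasurableSet.inter (MeasurableSet.iInter fun j => MeasurableSet.iInter fun hj => ?_)
    (MeasurableSet.iUnion fun j => (MeasurableSet.const (j ≤ n)).inter ?_)
  · exact measurableSet_le measurable_const ((hX _).sub (hX _))
  · exact measurableSet_le measurable_const (hX j)

/-- The event that one of the first `n` increments of `X` lies below `-1/2`. -/
def badEvent (X : ℕ → Ω → ℝ) (n : ℕ) : Set Ω :=
  {ω | ∃ k < n, X (k + 1) ω - X k ω < -(1 / 2)}

lemma measurableSet_badEvent (hX : ∀ k, Measurable (X k)) (n : ℕ) :
    MeasurableSet (badEvent X n) := by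
  simp only [badEvent, Set.ofPred_exists]
  exact MeasurableSet.iUnion fun j => (MeasurableSet.const (j < n)).inter
    (measurableSet_lt ((hX _).sub (hX _)) measurable_const)

lemma integrable_killedExponential_mul [IsFiniteMeasure μ] (hX : Martingale X 𝒢 μ)
    (h0 : ∀ ω, X 0 ω = 0) (x : ℝ) (k : ℕ) :
    Integrable (fun ω => killedExponential x (fun j => X j ω) k * (X (k + 1) ω - X k ω)) μ := by
  refine ((hX.integrable (k + 1)).sub (hX.integrable k)).bdd_mul (c := Real.exp x)
    ((stronglyMeasurable_killedExponential hX.1 x k).mono (𝒢.le k)).aestronglyMeasurable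
    (Eventually.of_forall fun ω => ?_)
  rw [Real.norm_of_nonneg (killedExponential_nonneg _ _ _)]
  exact killedExponential_le (h0 ω) k

lemma integral_killedExponential_mul [IsFiniteMeasure μ] (hX : Martingale X 𝒢 μ)
    (h0 : ∀ ω, X 0 ω = 0) (x : ℝ) (k : ℕ) :
    ∫ ω, killedExponential x (fun j => X j ω) k * (X (k + 1) ω - X k ω) ∂μ = 0 := by
  have hd : Integrable (X (k + 1) - X k) μ := (hX.integrable (k + 1)).sub (hX.integrable k)
  have h1 := condExp_mul_of_stronglyMeasurable_left (μ := μ) (m := 𝒢 k)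
    (stronglyMeasurable_killedExponential hX.1 x k)
    (integrable_killedExponential_mul hX h0 x k) hd
  have h2 : μ[X (k + 1) - X k | 𝒢 k] =ᵐ[μ] 0 := by
    refine (condExp_sub (hX.integrable _) (hX.integrable _) _).trans ?_
    filter_upwards [hX.2 k (k + 1) (Nat.le_succ k), hX.2 k k le_rfl] with ω h h'
    simp [h, h']
  rw [← integral_condExp (𝒢.le k)]
  rw [← integral_zero Ω ℝ (μ := μ)]
  refine integral_congr_ae (h1.trans ?_)
  filter_upwards [h2] with ω h
  change _ * (μ[X (k + 1) - X k | 𝒢 k]) ω = 0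
  rw [h, Pi.zero_apply, mul_zero]

/-- An overshoot on a step with increment below `-1/2` is controlled by the terminal value, because
`|X|` is a submartingale. -/
lemma setIntegral_badStep_le [IsFiniteMeasure μ] (hX : Martingale X 𝒢 μ) (x : ℝ) {k n : ℕ}
    (hk : k < n) :
    ∫ ω in {ω | BadStep x (fun j => X j ω) k}, (x + |X (k + 1) ω|) ∂μ ≤
      ∫ ω in {ω | BadStep x (fun j => X j ω) k}, (x + |X n ω|) ∂μ := by
  have hs : Submartingale (X ⊔ -X) 𝒢 μ := hX.submartingale.sup hX.neg.submartingale
  have habs : ∀ j ω, (X ⊔ -X) j ω = |X j ω| := fun j ω => rfl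
  have h := hs.setIntegral_le (Nat.succ_le_of_lt hk) (measurableSet_badStep hX.1 x k)
  simp only [habs] at h
  rw [integral_add (integrable_const x) (hX.integrable _).abs.integrableOn,
    integral_add (integrable_const x) (hX.integrable _).abs.integrableOn]
  exact add_le_add_right h _

open Classical in
lemma sum_setIntegral_badStep_le [IsFiniteMeasure μ] (hX : Martingale X 𝒢 μ) {x : ℝ} (hx : 0 ≤ x)
    (n : ℕ) :
    ∑ k ∈ Finset.range n, ∫ ω in {ω | BadStep x (fun j => X j ω) k}, (x + |X n ω|) ∂μ ≤
      ∫ ω in badEvent X n, (x + |X n ω|) ∂μ := by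
  have hint : Integrable (fun ω => x + |X n ω|) μ := (integrable_const x).add (hX.integrable n).abs
  have hm : ∀ k, Measurable (X k) := fun k =>
    (hX.stronglyMeasurable k).measurable.mono (𝒢.le k) le_rfl
  rw [← integral_biUnion_finset]
  · refine setIntegral_mono_set hint.integrableOn
      (Eventually.of_forall fun ω => by simp only [Pi.zero_apply]; positivity)
      (LE.le.eventuallyLE ?_)
    intro ω hω
    simp only [Set.mem_iUnion, Finset.mem_range] at hω
    obtain ⟨k, hk, hb⟩ := hω
    exact ⟨k, hk, hb.2⟩
  · exact fun k _ => 𝒢.le _ _ (measurableSet_badStep hX.1 x k)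
  · have aux : ∀ i j, i < j → Disjoint {ω | BadStep x (fun j => X j ω) i}
        {ω | BadStep x (fun j => X j ω) j} := by
      intro i j hij
      rw [Set.disjoint_left]
      intro ω hi hj
      exact absurd hi.2 (not_lt.2 (hj.1.2 i hij))
    intro i _ j _ hij
    rcases lt_or_gt_of_ne hij with h | h
    · exact aux i j h
    · exact (aux j i h).symm
  · exact fun k _ => hint.integrableOn

open Classical in
/-- The expectation of `exp (x - ∑ (ΔX)²)` over the good passages of the level `x` is at most `1`,
up to an error carried by the event that some increment lies below `-1/2`. -/
lemma lintegral_exp_passage_le [IsProbabilityMeasure μ] (hX : Martingale X 𝒢 μ)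
    (h0 : ∀ ω, X 0 ω = 0) {x : ℝ} (hx : 0 < x) (n : ℕ) :
    ∫⁻ ω, ENNReal.ofReal (if GoodPassage x (fun j => X j ω) n then
      Real.exp (x - ∑ j ∈ Finset.range n, (X (j + 1) ω - X j ω) ^ 2) else 0) ∂μ ≤
    ENNReal.ofReal (1 + Real.exp x * ∫ ω in badEvent X n, (x + |X n ω|) ∂μ) := by
  have hm : ∀ k, Measurable (X k) := fun k =>
    (hX.stronglyMeasurable k).measurable.mono (𝒢.le k) le_rfl
  have hB : ∀ k, MeasurableSet {ω | BadStep x (fun j => X j ω) k} :=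
    fun k => 𝒢.le _ _ (measurableSet_badStep hX.1 x k)
  have hint : ∀ k, Integrable (fun ω => x + |X k ω|) μ :=
    fun k => (integrable_const x).add (hX.integrable k).abs
  have hind : ∀ k, (fun ω => if BadStep x (fun j => X j ω) k then x + |X (k + 1) ω| else 0) =
      Set.indicator {ω | BadStep x (fun j => X j ω) k} (fun ω => x + |X (k + 1) ω|) := by
    intro k; ext ω; simp [Set.indicator_apply]
  have hIB : ∀ k, Integrable
      (fun ω => if BadStep x (fun j => X j ω) k then x + |X (k + 1) ω| else 0) μ := by
    intro k
    rw [hind]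
    exact (hint _).indicator (hB k)
  have hsum1 : Integrable (fun ω => ∑ k ∈ Finset.range n,
      killedExponential x (fun j => X j ω) k * (X (k + 1) ω - X k ω)) μ :=
    integrable_finsetSum _ fun k _ => integrable_killedExponential_mul hX h0 x k
  have hsum2 : Integrable (fun ω => Real.exp x * ∑ k ∈ Finset.range n,
      (if BadStep x (fun j => X j ω) k then x + |X (k + 1) ω| else 0)) μ :=
    (integrable_finsetSum _ fun k _ => hIB k).const_mul _
  have hsum0 : Integrable (fun ω => 1 + ∑ k ∈ Finset.range n,
      killedExponential x (fun j => X j ω) k * (X (k + 1) ω - X k ω)) μ :=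
    (integrable_const 1).add hsum1
  have hpt := fun ω => exp_passage_le (u := fun j => X j ω) hx (h0 ω) n
  refine (lintegral_mono fun ω => ENNReal.ofReal_le_ofReal (hpt ω)).trans ?_
  have hsum : Integrable (fun ω => 1 + ∑ k ∈ Finset.range n,
      killedExponential x (fun j => X j ω) k * (X (k + 1) ω - X k ω) +
      Real.exp x * ∑ k ∈ Finset.range n,
        (if BadStep x (fun j => X j ω) k then x + |X (k + 1) ω| else 0)) μ := hsum0.add hsum2
  rw [← ofReal_integral_eq_lintegral_ofReal hsum (Eventually.of_forall fun ω => ?_)]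
  · refine ENNReal.ofReal_le_ofReal ?_
    rw [integral_add hsum0 hsum2, integral_add (integrable_const 1) hsum1,
      integral_finsetSum _ fun k _ => integrable_killedExponential_mul hX h0 x k,
      integral_const_mul, integral_finsetSum _ fun k _ => hIB k]
    simp only [integral_killedExponential_mul hX h0, Finset.sum_const_zero, integral_const,
      probReal_univ, smul_eq_mul, mul_one, add_zero]
    gcongr
    refine le_trans (Finset.sum_le_sum fun k hk => ?_) (sum_setIntegral_badStep_le hX hx.le n)
    rw [hind, integral_indicator (hB k)]
    exact setIntegral_badStep_le hX x (Finset.mem_range.1 hk)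
  · refine le_trans ?_ (hpt ω)
    split_ifs
    · exact (Real.exp_pos _).le
    · exact le_rfl

end Discrete

/-! ### Continuous-time martingales on dyadic grids -/

/-- The `k`-th point of the `n`-th dyadic partition of `[0, T]`. -/
noncomputable def dyadicPoint (T : ℝ≥0) (n k : ℕ) : ℝ≥0 := T * (k : ℝ≥0) / 2 ^ n

lemma dyadicPoint_zero (T : ℝ≥0) (n : ℕ) : dyadicPoint T n 0 = 0 := by simp [dyadicPoint]

lemma dyadicPoint_two_pow (T : ℝ≥0) (n : ℕ) : dyadicPoint T n (2 ^ n) = T := by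
  simp [dyadicPoint]

lemma dyadicPoint_mono (T : ℝ≥0) (n : ℕ) : Monotone (dyadicPoint T n) := by
  intro j k hjk
  unfold dyadicPoint
  gcongr

lemma dyadicPoint_le (T : ℝ≥0) {n k : ℕ} (hk : k ≤ 2 ^ n) : dyadicPoint T n k ≤ T :=
  (dyadicPoint_mono T n hk).trans_eq (dyadicPoint_two_pow T n)

lemma dyadicPoint_add (T : ℝ≥0) (n m k : ℕ) :
    dyadicPoint T (n + m) (k * 2 ^ m) = dyadicPoint T n k := by
  unfold dyadicPoint
  push_cast
  rw [pow_add, ← mul_assoc, mul_div_mul_right _ _ (by positivity)]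

lemma dist_dyadicPoint_succ (T : ℝ≥0) (n k : ℕ) :
    dist (dyadicPoint T n (k + 1)) (dyadicPoint T n k) = T / 2 ^ n := by
  rw [NNReal.dist_eq]
  have : ((dyadicPoint T n (k + 1) : ℝ≥0) : ℝ) - (dyadicPoint T n k : ℝ≥0) = T / 2 ^ n := by
    simp only [dyadicPoint]
    push_cast
    ring
  rw [this, abs_of_nonneg (by positivity)]

lemma eventually_increment_lt {f : ℝ≥0 → ℝ} (hf : Continuous f) (T : ℝ≥0) :
    ∀ᶠ n in atTop, ∀ k < 2 ^ n,
      |f (dyadicPoint T n (k + 1)) - f (dyadicPoint T n k)| < 1 / 2 := by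
  have huc := (isCompact_Icc (a := (0 : ℝ≥0)) (b := T)).uniformContinuousOn_of_continuous
    hf.continuousOn
  obtain ⟨δ, hδ, h⟩ := Metric.uniformContinuousOn_iff.1 huc (1 / 2) (by norm_num)
  have ht : Tendsto (fun n : ℕ => (T : ℝ) / 2 ^ n) atTop (nhds 0) := by
    have := (tendsto_pow_atTop_nhds_zero_of_lt_one (r := (1 / 2 : ℝ)) (by norm_num)
      (by norm_num)).const_mul (T : ℝ)
    simpa [div_eq_mul_inv] using this
  filter_upwards [ht.eventually_lt_const hδ] with n hn k hk
  rw [← Real.dist_eq]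
  refine h _ ⟨zero_le, dyadicPoint_le T hk⟩ _ ⟨zero_le, dyadicPoint_le T hk.le⟩ ?_
  rwa [dist_dyadicPoint_succ]

/-- The supremum of a process over the dyadic points of `[0, T]`. For continuous paths this is the
supremum over `[0, T]`; restricting to countably many times makes it measurable. -/
noncomputable def dyadicSup {Ω : Type*} (M : ℝ≥0 → Ω → ℝ) (T : ℝ≥0) (ω : Ω) : ℝ :=
  ⨆ p : (n : ℕ) × Fin (2 ^ n + 1), M (dyadicPoint T p.1 p.2) ω

section Path

variable {Ω : Type*} {M : ℝ≥0 → Ω → ℝ} {T : ℝ≥0} {ω : Ω}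

lemma bddAbove_dyadic (hc : Continuous fun t => M t ω) :
    BddAbove (Set.range fun p : (n : ℕ) × Fin (2 ^ n + 1) => M (dyadicPoint T p.1 p.2) ω) := by
  obtain ⟨b, hb⟩ := (isCompact_Icc (a := (0 : ℝ≥0)) (b := T)).bddAbove_image hc.continuousOn
  refine ⟨b, ?_⟩
  rintro _ ⟨p, rfl⟩
  exact hb ⟨_, ⟨zero_le, dyadicPoint_le T (Nat.lt_succ_iff.1 p.2.2)⟩, rfl⟩

lemma le_dyadicSup (hc : Continuous fun t => M t ω) {n k : ℕ} (hk : k ≤ 2 ^ n) :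
    M (dyadicPoint T n k) ω ≤ dyadicSup M T ω :=
  le_ciSup (bddAbove_dyadic hc)
    (⟨n, ⟨k, Nat.lt_succ_of_le hk⟩⟩ : (n : ℕ) × Fin (2 ^ n + 1))

lemma le_dyadicSup_of_le (hc : Continuous fun t => M t ω) {s : ℝ≥0} (hs : s ≤ T) :
    M s ω ≤ dyadicSup M T ω := by
  rcases eq_or_ne T 0 with rfl | hT
  · obtain rfl : s = 0 := le_antisymm hs zero_le
    simpa [dyadicPoint] using le_dyadicSup (T := 0) hc (n := 0) (k := 0) (by simp)
  have hT' : (0 : ℝ) < T := by exact_mod_cast pos_iff_ne_zero.2 hT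
  -- `s` is the limit of the dyadic points `T * ⌊2 ^ n * (s / T)⌋ / 2 ^ n`.
  have h1 : Tendsto (fun n : ℕ => (⌊(s / T : ℝ) * 2 ^ n⌋₊ : ℝ) / 2 ^ n) atTop
      (nhds (s / T)) :=
    (tendsto_nat_floor_mul_div_atTop (by positivity : (0 : ℝ) ≤ s / T)).comp
      (tendsto_pow_atTop_atTop_of_one_lt (r := (2 : ℝ)) one_lt_two)
  have h2 : Tendsto (fun n : ℕ => dyadicPoint T n ⌊(s / T : ℝ) * 2 ^ n⌋₊) atTop (nhds s) := by
    have := h1.const_mul (T : ℝ)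
    rw [mul_div_cancel₀ _ hT'.ne'] at this
    rw [← NNReal.tendsto_coe]
    simpa [dyadicPoint, mul_div_assoc] using this
  refine le_of_tendsto ((hc.tendsto s).comp h2) (Eventually.of_forall fun n => ?_)
  refine le_dyadicSup hc (Nat.floor_le_of_le ?_)
  push_cast
  calc (s / T : ℝ) * 2 ^ n ≤ 1 * 2 ^ n := by
        gcongr
        exact div_le_one_of_le₀ (by exact_mod_cast hs) hT'.le
    _ = 2 ^ n := one_mul _

lemma eventually_exists_le_of_lt_dyadicSup {x : ℝ} (hx : x < dyadicSup M T ω) :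
    ∀ᶠ n in atTop, ∃ k ≤ 2 ^ n, x ≤ M (dyadicPoint T n k) ω := by
  obtain ⟨⟨m, k⟩, hk⟩ := exists_lt_of_lt_ciSup hx
  filter_upwards [eventually_ge_atTop m] with n hn
  obtain ⟨d, rfl⟩ := Nat.exists_eq_add_of_le hn
  refine ⟨k * 2 ^ d, ?_, ?_⟩
  · rw [pow_add]
    exact Nat.mul_le_mul_right _ (Nat.lt_succ_iff.1 k.2)
  · rw [dyadicPoint_add]
    exact hk.le

end Path

section Continuous

variable {Ω : Type*} {mΩ : MeasurableSpace Ω} {μ : Measure Ω} {𝓕 : Filtration ℝ≥0 mΩ}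
  {M : ℝ≥0 → Ω → ℝ}

/-- The filtration observed at the `n`-th dyadic grid of `[0, T]`. -/
noncomputable def dyadicFiltration (𝓕 : Filtration ℝ≥0 mΩ) (T : ℝ≥0) (n : ℕ) :
    Filtration ℕ mΩ where
  seq k := 𝓕 (dyadicPoint T n k)
  mono' _ _ h := 𝓕.mono (dyadicPoint_mono T n h)
  le' _ := 𝓕.le _

lemma martingale_dyadic (hM : Martingale M 𝓕 μ) (T : ℝ≥0) (n : ℕ) :
    Martingale (fun k => M (dyadicPoint T n k)) (dyadicFiltration 𝓕 T n) μ :=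
  ⟨fun _ => hM.1 _, fun _ _ h => hM.2 _ _ (dyadicPoint_mono T n h)⟩

lemma measurable_dyadicSup (hM : ∀ t, Measurable (M t)) (T : ℝ≥0) :
    Measurable (dyadicSup M T) :=
  Measurable.iSup fun _ => hM _

/-- Exponential maximal inequality: if the sums of squared increments of a continuous martingale
null at `0` converge to `V` along a subsequence of the dyadic partitions, then the event that the
martingale exceeds `x` has weight at most `exp (-x)` under the measure with density `exp (-V)`. -/
lemma setLIntegral_exp_neg_le [IsProbabilityMeasure μ] (hM : Martingale M 𝓕 μ)
    (hc : ∀ᵐ ω ∂μ, Continuous fun t => M t ω) (h0 : ∀ ω, M 0 ω = 0) (T : ℝ≥0) {V : Ω → ℝ}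
    {φ : ℕ → ℕ} (hφ : StrictMono φ)
    (hV : ∀ᵐ ω ∂μ, Tendsto (fun n => sqIncrements M T (φ n) ω) atTop (nhds (V ω)))
    {x : ℝ} (hx : 0 < x) :
    ∫⁻ ω in {ω | x < dyadicSup M T ω}, ENNReal.ofReal (Real.exp (-V ω)) ∂μ ≤
      ENNReal.ofReal (Real.exp (-x)) := by
  classical
  have hm : ∀ t, Measurable (M t) := fun t =>
    (hM.stronglyMeasurable t).measurable.mono (𝓕.le t) le_rfl
  have hset : MeasurableSet {ω | x < dyadicSup M T ω} :=
    measurableSet_lt measurable_const (measurable_dyadicSup hm T)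
  set X : ℕ → ℕ → Ω → ℝ := fun n k => M (dyadicPoint T (φ n) k) with hX
  set F : ℕ → Ω → ℝ≥0∞ := fun n ω =>
    ENNReal.ofReal (if GoodPassage x (fun j => X n j ω) (2 ^ φ n) then
      Real.exp (x - ∑ j ∈ Finset.range (2 ^ φ n), (X n (j + 1) ω - X n j ω) ^ 2) else 0) with hF
  have hFm : ∀ n, Measurable (F n) := by
    intro n
    refine ENNReal.measurable_ofReal.comp (Measurable.ite
      (measurableSet_goodPassage (fun k => hm _) x _) ?_ measurable_const)
    exact Real.measurable_exp.comp (measurable_const.sub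
      (Finset.measurable_sum _ fun j _ => ((hm _).sub (hm _)).pow_const 2))
  have hosc : ∀ᵐ ω ∂μ, ∀ᶠ n in atTop, ∀ k < 2 ^ φ n, |X n (k + 1) ω - X n k ω| < 1 / 2 := by
    filter_upwards [hc] with ω hω
    exact hφ.tendsto_atTop.eventually (eventually_increment_lt hω T)
  -- The error term of the discrete estimate vanishes since paths are uniformly continuous.
  have herr : Tendsto (fun n => ∫ ω in badEvent (X n) (2 ^ φ n), (x + |X n (2 ^ φ n) ω|) ∂μ)
      atTop (nhds 0) := by
    have hXT : ∀ n, X n (2 ^ φ n) = M T := fun n => by simp only [hX, dyadicPoint_two_pow]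
    simp only [hXT]
    have hB : ∀ n, MeasurableSet (badEvent (X n) (2 ^ φ n)) :=
      fun n => measurableSet_badEvent (fun k => hm _) _
    simp only [← integral_indicator (hB _)]
    rw [← integral_zero Ω ℝ (μ := μ)]
    refine tendsto_integral_of_dominated_convergence (fun ω => x + |M T ω|)
      (fun n => ((measurable_const.add (hm T).abs).indicator (hB n)).aestronglyMeasurable)
      ((integrable_const x).add (hM.integrable T).abs) (fun n => ae_of_all _ fun ω => ?_) ?_
    · refine (norm_indicator_le_norm_self _ _).trans_eq (Real.norm_of_nonneg ?_)
      positivity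
    · filter_upwards [hosc] with ω hω
      refine tendsto_const_nhds.congr' ?_
      filter_upwards [hω] with n hn
      rw [Set.indicator_of_notMem]
      rintro ⟨k, hk, hlt⟩
      linarith [(abs_lt.1 (hn k hk)).1]
  have hFint : ∀ n, ∫⁻ ω, F n ω ∂μ ≤ ENNReal.ofReal
      (1 + Real.exp x * ∫ ω in badEvent (X n) (2 ^ φ n), (x + |X n (2 ^ φ n) ω|) ∂μ) := fun n =>
    lintegral_exp_passage_le (martingale_dyadic hM T (φ n))
      (fun ω => by rw [dyadicPoint_zero]; exact h0 ω) hx _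
  have hlim : ∫⁻ ω, liminf (fun n => F n ω) atTop ∂μ ≤ 1 := by
    refine (lintegral_liminf_le hFm).trans ?_
    refine (liminf_le_liminf (Eventually.of_forall hFint)).trans_eq ?_
    refine Tendsto.liminf_eq ?_
    have := ENNReal.tendsto_ofReal ((herr.const_mul (Real.exp x)).const_add 1)
    simpa using this
  have hpt : ∀ᵐ ω ∂μ, Set.indicator {ω | x < dyadicSup M T ω}
      (fun ω => ENNReal.ofReal (Real.exp (x - V ω))) ω ≤ liminf (fun n => F n ω) atTop := by
    filter_upwards [hosc, hV] with ω h1 h2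
    by_cases hω : x < dyadicSup M T ω
    · rw [Set.indicator_of_mem (by exact hω)]
      refine le_of_eq (Tendsto.liminf_eq ?_).symm
      have h3 : Tendsto (fun n => ENNReal.ofReal (Real.exp (x - sqIncrements M T (φ n) ω))) atTop
          (nhds (ENNReal.ofReal (Real.exp (x - V ω)))) :=
        ENNReal.tendsto_ofReal ((Real.continuous_exp.tendsto _).comp (h2.const_sub x))
      refine h3.congr' ?_
      filter_upwards [h1, hφ.tendsto_atTop.eventually
        (eventually_exists_le_of_lt_dyadicSup hω)] with n hn1 hn2
      have hg : GoodPassage x (fun j => X n j ω) (2 ^ φ n) :=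
        ⟨fun k hk => (abs_lt.1 (hn1 k hk)).1.le, hn2⟩
      simp only [hF, hg, if_true]
      rfl
    · rw [Set.indicator_of_notMem (by exact hω)]
      exact zero_le
  have hfin := (lintegral_mono_ae hpt).trans hlim
  rw [lintegral_indicator hset] at hfin
  have hsplit : ∀ ω, ENNReal.ofReal (Real.exp (-V ω)) =
      ENNReal.ofReal (Real.exp (-x)) * ENNReal.ofReal (Real.exp (x - V ω)) := by
    intro ω
    rw [← ENNReal.ofReal_mul (Real.exp_pos _).le, ← Real.exp_add]
    ring_nf
  simp only [hsplit]
  rw [lintegral_const_mul' _ _ ENNReal.ofReal_ne_top]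
  exact (mul_le_mul_right hfin _).trans_eq (mul_one _)

end Continuous

/-! ### Exponential moments of the maximum -/

section Moments

variable {Ω : Type*} {mΩ : MeasurableSpace Ω}

lemma lintegral_exp_two_thirds_le {ν : Measure Ω} (hν : ν Set.univ ≤ 1) {Y : Ω → ℝ}
    (hY : Measurable Y) (hY0 : 0 ≤ᵐ[ν] Y)
    (htail : ∀ x, 0 < x → ν {ω | x < Y ω} ≤ ENNReal.ofReal (Real.exp (-x))) :
    ∫⁻ ω, ENNReal.ofReal (Real.exp (2 / 3 * Y ω)) ∂ν ≤ 3 := by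
  have hcont : Continuous fun t : ℝ => 2 / 3 * Real.exp (2 / 3 * t) := by fun_prop
  have hprim : ∀ y : ℝ, ∫ t in (0 : ℝ)..y, 2 / 3 * Real.exp (2 / 3 * t) =
      Real.exp (2 / 3 * y) - 1 := by
    intro y
    rw [intervalIntegral.integral_eq_sub_of_hasDerivAt
      (f := fun t => Real.exp (2 / 3 * t)) (fun t _ => ?_) (hcont.intervalIntegrable _ _)]
    · simp
    · have := ((hasDerivAt_id t).const_mul (2 / 3 : ℝ)).exp
      simpa [mul_comm] using this
  have hlc := lintegral_comp_eq_lintegral_meas_lt_mul ν hY0 hY.aemeasurable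
    (g := fun t => 2 / 3 * Real.exp (2 / 3 * t)) (fun t _ => hcont.intervalIntegrable _ _)
    (ae_of_all _ fun t => by positivity)
  simp only [hprim] at hlc
  have htwo : ∫⁻ t in Set.Ioi (0 : ℝ), ENNReal.ofReal (2 / 3 * Real.exp (-(1 / 3) * t)) = 2 := by
    rw [← ofReal_integral_eq_lintegral_ofReal
      ((integrableOn_exp_mul_Ioi (by norm_num) 0).const_mul _) (ae_of_all _ fun t => by positivity),
      integral_const_mul, integral_exp_mul_Ioi (by norm_num)]
    norm_num
  have hle : ∫⁻ ω, ENNReal.ofReal (Real.exp (2 / 3 * Y ω) - 1) ∂ν ≤ 2 := by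
    rw [hlc, ← htwo]
    refine setLIntegral_mono (by fun_prop) fun t ht => ?_
    calc ν {ω | t < Y ω} * ENNReal.ofReal (2 / 3 * Real.exp (2 / 3 * t))
        ≤ ENNReal.ofReal (Real.exp (-t)) * ENNReal.ofReal (2 / 3 * Real.exp (2 / 3 * t)) :=
          mul_le_mul_left (htail t ht) _
      _ = ENNReal.ofReal (2 / 3 * Real.exp (-(1 / 3) * t)) := by
          rw [← ENNReal.ofReal_mul (Real.exp_pos _).le, mul_left_comm, ← Real.exp_add]
          ring_nf
  calc ∫⁻ ω, ENNReal.ofReal (Real.exp (2 / 3 * Y ω)) ∂ν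
      ≤ ∫⁻ ω, (1 + ENNReal.ofReal (Real.exp (2 / 3 * Y ω) - 1)) ∂ν := by
        refine lintegral_mono fun ω => ?_
        rw [← ENNReal.ofReal_one]
        refine le_trans (ENNReal.ofReal_le_ofReal ?_) ENNReal.ofReal_add_le
        linarith
    _ = ν Set.univ + ∫⁻ ω, ENNReal.ofReal (Real.exp (2 / 3 * Y ω) - 1) ∂ν := by
        rw [lintegral_add_left measurable_const, lintegral_const, one_mul]
    _ ≤ 1 + 2 := add_le_add hν hle
    _ = 3 := by norm_num

/-- The exponential moment of the maximum of a continuous martingale null at `0` is controlled by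
the exponential moment of its quadratic variation `V`. -/
lemma lintegral_exp_dyadicSup_le {μ : Measure Ω} [IsProbabilityMeasure μ]
    {𝓕 : Filtration ℝ≥0 mΩ} {M : ℝ≥0 → Ω → ℝ} (hM : Martingale M 𝓕 μ)
    (hc : ∀ᵐ ω ∂μ, Continuous fun t => M t ω) (h0 : ∀ ω, M 0 ω = 0) (T : ℝ≥0) {V : Ω → ℝ}
    {φ : ℕ → ℕ} (hφ : StrictMono φ)
    (hV : ∀ᵐ ω ∂μ, Tendsto (fun n => sqIncrements M T (φ n) ω) atTop (nhds (V ω))) :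
    ∫⁻ ω, ENNReal.ofReal (Real.exp (dyadicSup M T ω / 3)) ∂μ ≤
      ENNReal.ofReal (Real.exp 1) *
        (∫⁻ ω, ENNReal.ofReal (Real.exp (V ω)) ∂μ) ^ (1 / 2 : ℝ) := by
  have hm : ∀ t, Measurable (M t) := fun t =>
    (hM.stronglyMeasurable t).measurable.mono (𝓕.le t) le_rfl
  have hY : Measurable (dyadicSup M T) := measurable_dyadicSup hm T
  have hVm : AEMeasurable V μ := by
    refine aemeasurable_of_tendsto_metrizable_ae atTop (fun n => ?_) hV
    exact (Finset.measurable_sum _ fun j _ => ((hm _).sub (hm _)).pow_const 2).aemeasurable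
  have hV0 : ∀ᵐ ω ∂μ, 0 ≤ V ω := by
    filter_upwards [hV] with ω h
    exact ge_of_tendsto' h fun n => Finset.sum_nonneg fun _ _ => sq_nonneg _
  have hdm : AEMeasurable (fun ω => ENNReal.ofReal (Real.exp (-V ω))) μ := by fun_prop
  set ν := μ.withDensity fun ω => ENNReal.ofReal (Real.exp (-V ω)) with hν
  have hν1 : ν Set.univ ≤ 1 := by
    rw [hν, withDensity_apply _ MeasurableSet.univ, Measure.restrict_univ]
    calc ∫⁻ ω, ENNReal.ofReal (Real.exp (-V ω)) ∂μ ≤ ∫⁻ _, 1 ∂μ := by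
          refine lintegral_mono_ae ?_
          filter_upwards [hV0] with ω h
          rw [← ENNReal.ofReal_one]
          exact ENNReal.ofReal_le_ofReal (Real.exp_le_one_iff.2 (by linarith))
      _ = 1 := by simp
  have hY0 : 0 ≤ᵐ[ν] dyadicSup M T := by
    refine (withDensity_absolutelyContinuous μ _).ae_le ?_
    filter_upwards [hc] with ω h
    have := le_dyadicSup_of_le (T := T) h (zero_le (a := T))
    rwa [h0] at this
  have h3 := lintegral_exp_two_thirds_le hν1 hY hY0 fun x hx => by
    rw [hν, withDensity_apply _ (measurableSet_lt measurable_const hY)]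
    exact setLIntegral_exp_neg_le hM hc h0 T hφ hV hx
  rw [hν, lintegral_withDensity_eq_lintegral_mul₀ hdm (by fun_prop)] at h3
  -- Cauchy-Schwarz for `exp (Y / 3) = exp (Y / 3 - V / 2) * exp (V / 2)`.
  have hCS := ENNReal.lintegral_mul_le_Lp_mul_Lq μ Real.HolderConjugate.two_two
    (f := fun ω => ENNReal.ofReal (Real.exp (dyadicSup M T ω / 3 - V ω / 2)))
    (g := fun ω => ENNReal.ofReal (Real.exp (V ω / 2))) (by fun_prop) (by fun_prop)
  simp only [Pi.mul_apply, ENNReal.rpow_two] at hCS h3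
  have e1 : ∀ ω, ENNReal.ofReal (Real.exp (dyadicSup M T ω / 3 - V ω / 2)) *
      ENNReal.ofReal (Real.exp (V ω / 2)) = ENNReal.ofReal (Real.exp (dyadicSup M T ω / 3)) := by
    intro ω
    rw [← ENNReal.ofReal_mul (Real.exp_pos _).le, ← Real.exp_add, sub_add_cancel]
  have e2 : ∀ ω, ENNReal.ofReal (Real.exp (dyadicSup M T ω / 3 - V ω / 2)) ^ 2 =
      ENNReal.ofReal (Real.exp (-V ω)) * ENNReal.ofReal (Real.exp (2 / 3 * dyadicSup M T ω)) := by
    intro ω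
    rw [sq, ← ENNReal.ofReal_mul (Real.exp_pos _).le, ← ENNReal.ofReal_mul (Real.exp_pos _).le,
      ← Real.exp_add, ← Real.exp_add]
    ring_nf
  have e3 : ∀ ω, ENNReal.ofReal (Real.exp (V ω / 2)) ^ 2 = ENNReal.ofReal (Real.exp (V ω)) := by
    intro ω
    rw [sq, ← ENNReal.ofReal_mul (Real.exp_pos _).le, ← Real.exp_add, add_halves]
  simp only [e1, e2, e3] at hCS
  refine hCS.trans (mul_le_mul_left ?_ _)
  refine (ENNReal.rpow_le_rpow h3 (by norm_num)).trans ?_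
  rw [← ENNReal.ofReal_ofNat, ENNReal.ofReal_rpow_of_nonneg (by norm_num) (by norm_num)]
  refine ENNReal.ofReal_le_ofReal ?_
  rw [← Real.sqrt_eq_rpow]
  exact Real.sqrt_le_iff.2 ⟨(Real.exp_pos _).le, by nlinarith [Real.exp_one_gt_d9]⟩

end Moments

/-! ### The pathwise Gronwall bound -/

section Gronwall

variable {Ω : Type*} {l : ℝ≥0 → Ω → ℝ} {ω : Ω}

lemma continuous_runningSup (hl : Continuous fun t => l t ω) :
    Continuous fun t => runningSup l t ω := by
  have h : ∀ t, runningSup l t ω =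
      sSup ((fun s : ℝ≥0 => l (s * t) ω) '' Set.Icc 0 1) := by
    intro t
    rw [runningSup, ← sSup_image' (f := fun s => l s ω)]
    congr 1
    ext y
    constructor
    · rintro ⟨s, hs, rfl⟩
      rcases eq_or_ne t 0 with rfl | ht
      · exact ⟨0, by simp, by simp [le_antisymm hs.2 hs.1]⟩
      · refine ⟨s / t, ⟨zero_le, div_le_one_of_le₀ hs.2 zero_le⟩, ?_⟩
        simp only [div_mul_cancel₀ s ht]
    · rintro ⟨s, hs, rfl⟩
      exact ⟨s * t, ⟨zero_le, mul_le_of_le_one_left zero_le hs.2⟩, rfl⟩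
  simp only [h]
  exact isCompact_Icc.continuous_sSup (f := fun t s => l (s * t) ω)
    (hl.comp (continuous_snd.mul continuous_fst))

lemma le_runningSup (hl : Continuous fun t => l t ω) {s t : ℝ≥0} (hst : s ≤ t) :
    l s ω ≤ runningSup l t ω := by
  have hb : BddAbove (Set.range fun s : Set.Icc (0 : ℝ≥0) t => l s ω) := by
    obtain ⟨b, hb⟩ := (isCompact_Icc (a := (0 : ℝ≥0)) (b := t)).bddAbove_image hl.continuousOn
    exact ⟨b, by rintro _ ⟨s, rfl⟩; exact hb ⟨s, s.2, rfl⟩⟩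
  exact le_ciSup hb (⟨s, zero_le, hst⟩ : Set.Icc (0 : ℝ≥0) t)

lemma gronwallBound_zero_le {c a T : ℝ} (hc : 0 ≤ c) (ha : 0 ≤ a) :
    gronwallBound 0 c a T ≤ T * Real.exp (c * T) * a := by
  rcases eq_or_ne c 0 with rfl | hc0
  · simp [gronwallBound_K0, mul_comm]
  · rw [gronwallBound_of_K_ne_0 hc0]
    have h1 : Real.exp (c * T) - 1 ≤ c * T * Real.exp (c * T) := by
      have h2 := Real.add_one_le_exp (-(c * T))
      have h3 : Real.exp (c * T) * Real.exp (-(c * T)) = 1 := by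
        rw [← Real.exp_add]; simp
      nlinarith [mul_le_mul_of_nonneg_left h2 (Real.exp_pos (c * T)).le]
    calc 0 * Real.exp (c * T) + a / c * (Real.exp (c * T) - 1)
        ≤ 0 * Real.exp (c * T) + a / c * (c * T * Real.exp (c * T)) := by gcongr
      _ = T * Real.exp (c * T) * a := by field_simp; ring

lemma integral_runningSup_le (hl : Continuous fun t => l t ω) (hl0 : ∀ t, 0 ≤ l t ω)
    {c a : ℝ} (hc : 0 ≤ c) (ha : 0 ≤ a) {T : ℝ≥0}
    (h : ∀ t ≤ T, l t ω ≤ a + c * ∫ r in (0 : ℝ)..t, runningSup l r.toNNReal ω) :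
    ∫ r in (0 : ℝ)..T, runningSup l r.toNNReal ω ≤ T * Real.exp (c * T) * a := by
  set L : ℝ → ℝ := fun r => runningSup l r.toNNReal ω with hL
  have hLc : Continuous L := (continuous_runningSup hl).comp continuous_real_toNNReal
  have hL0 : ∀ r, 0 ≤ L r := fun r => (hl0 0).trans (le_runningSup hl zero_le)
  have hG0 : ∀ t, 0 ≤ t → 0 ≤ ∫ r in (0 : ℝ)..t, L r := fun t ht =>
    intervalIntegral.integral_nonneg ht fun r _ => hL0 r
  have hLle : ∀ t ∈ Set.Ico (0 : ℝ) T, L t ≤ a + c * ∫ r in (0 : ℝ)..t, L r := by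
    intro t ht
    have : Nonempty (Set.Icc (0 : ℝ≥0) t.toNNReal) := ⟨⟨0, le_rfl, zero_le⟩⟩
    refine ciSup_le fun s => ?_
    have hst : ((s : ℝ≥0) : ℝ) ≤ t := (Real.le_toNNReal_iff_coe_le ht.1).1 s.2.2
    refine (h s (by exact_mod_cast hst.trans ht.2.le)).trans ?_
    have : ∫ r in (0 : ℝ)..(s : ℝ≥0), L r ≤ ∫ r in (0 : ℝ)..t, L r :=
      intervalIntegral.integral_mono_interval le_rfl (s : ℝ≥0).2 hst
        (ae_of_all _ hL0) (hLc.intervalIntegrable _ _)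
    gcongr
  have hd : ∀ t, HasDerivAt (fun t => ∫ r in (0 : ℝ)..t, L r) (L t) t := fun t =>
    intervalIntegral.integral_hasDerivAt_right (hLc.intervalIntegrable _ _)
      (hLc.stronglyMeasurableAtFilter _ _) hLc.continuousAt
  have hgr := norm_le_gronwallBound_of_norm_deriv_right_le (f := fun t => ∫ r in (0 : ℝ)..t, L r)
    (f' := L) (δ := 0) (K := c) (ε := a) (a := 0) (b := T)
    (fun t _ => (hd t).continuousAt.continuousWithinAt) (fun t _ => (hd t).hasDerivWithinAt)
    (by simp) (fun t ht => by
      rw [Real.norm_of_nonneg (hL0 t), Real.norm_of_nonneg (hG0 t ht.1)]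
      linarith [hLle t ht]) T ⟨T.2, le_rfl⟩
  rw [sub_zero] at hgr
  exact (le_abs_self _).trans (hgr.trans (gronwallBound_zero_le hc ha))

end Gronwall

lemma IsContinuousSemimartingale.ae_continuous {Ω : Type*} {mΩ : MeasurableSpace Ω}
    {X : ℝ≥0 → Ω → ℝ} {𝓕 : Filtration ℝ≥0 mΩ} {μ : Measure Ω}
    (hX : IsContinuousSemimartingale X 𝓕 μ) : ∀ᵐ ω ∂μ, Continuous fun t => X t ω := by
  obtain ⟨-, N, A, hN, hA, h⟩ := hX
  filter_upwards [hN.continuous, hA.continuous, h] with ω h1 h2 h3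
  exact ((continuous_const.add h1).add h2).congr fun t => (h3 t).symm

/-! ### The exponential estimate for the time integral of the running supremum -/

theorem lemma3p1 {Ω : Type*} {mΩ : MeasurableSpace Ω} (μ : Measure Ω) [IsProbabilityMeasure μ]
    (𝓕 : Filtration ℝ≥0 mΩ) (l M : ℝ≥0 → Ω → ℝ)
    (hl : IsContinuousSemimartingale l 𝓕 μ)
    (hl_nonneg : ∀ᵐ ω ∂μ, ∀ t, 0 ≤ l t ω)
    (l₀ : ℝ) (hl₀ : ∀ᵐ ω ∂μ, l 0 ω = l₀)
    (hM : Martingale M 𝓕 μ)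
    (hM_cont : ∀ᵐ ω ∂μ, Continuous fun t => M t ω)
    (hM_zero : ∀ᵐ ω ∂μ, M 0 ω = 0)
    (c : ℝ) (hc : 0 ≤ c)
    (hlM : ∀ᵐ ω ∂μ, ∀ s t : ℝ≥0, s ≤ t →
      l t ω - l s ω ≤ M t ω - M s ω + c * ∫ r in (s : ℝ)..t, runningSup l r.toNNReal ω)
    (T : ℝ≥0) (hT : 0 < T) (ε : ℝ) (hε : 0 ≤ ε) :
    ∫⁻ ω, ENNReal.ofReal (Real.exp (ε / (T * Real.exp (1 + c * T)) *
        ∫ t in (0 : ℝ)..T, runningSup l t.toNNReal ω)) ∂μ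
      ≤ ENNReal.ofReal (Real.exp (ε * l₀ + 1)) *
        (∫⁻ ω, EReal.exp (((2 * ε ^ 2 : ℝ) : EReal) * (quadVar M μ T ω : EReal)) ∂μ) ^
          (1 / 2 : ℝ) := by
  by_cases hQ : ∃ V : Ω → ℝ, TendstoInMeasure μ (sqIncrements M T) atTop V
  swap
  · -- For a continuous martingale the squared increments always converge, so this case is void;
    -- the existence theorem is not needed, as `quadVar` is `∞` in the absence of a limit.
    have hq : ∀ ω, quadVar M μ T ω = ∞ := fun ω => by simp only [quadVar, dif_neg hQ]
    rcases hε.eq_or_lt with rfl | hε'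
    · simp
    · have hpos : (0 : ℝ) < 2 * ε ^ 2 := by positivity
      simp only [hq, EReal.coe_ennreal_top, EReal.coe_mul_top_of_pos hpos, EReal.exp_top,
        lintegral_const, measure_univ, mul_one]
      rw [ENNReal.top_rpow_of_pos (by norm_num),
        ENNReal.mul_top (ENNReal.ofReal_pos.2 (Real.exp_pos _)).ne']
      exact le_top
  obtain ⟨V, hV⟩ := hQ
  obtain ⟨φ, hφ, hVφ⟩ := hV.exists_seq_tendsto_ae
  have hTR : (0 : ℝ) < T := by exact_mod_cast hT
  -- The estimate for the maximum is applied to the rescaled martingale `κ (M - M 0)`.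
  set κ : ℝ := 3 * ε / Real.exp 1 with hκ
  have hκ0 : 0 ≤ κ := by positivity
  have hκ2 : κ ^ 2 ≤ 2 * ε ^ 2 := by
    rw [hκ, div_pow, div_le_iff₀ (by positivity)]
    have : (9 / 2 : ℝ) ≤ Real.exp 1 ^ 2 := by nlinarith [Real.exp_one_gt_d9]
    nlinarith [sq_nonneg ε]
  set N : ℝ≥0 → Ω → ℝ := κ • (M - fun _ => M 0) with hN
  have hNapp : ∀ t ω, N t ω = κ * (M t ω - M 0 ω) := fun t ω => rfl
  have hN_mart : Martingale N 𝓕 μ := by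
    refine Martingale.smul κ (hM.sub ⟨fun t => (hM.1 0).mono (𝓕.mono zero_le), fun s t _ => ?_⟩)
    rw [condExp_of_stronglyMeasurable (𝓕.le s) ((hM.1 0).mono (𝓕.mono zero_le)) (hM.integrable 0)]
  have hN_cont : ∀ᵐ ω ∂μ, Continuous fun t => N t ω := by
    filter_upwards [hM_cont] with ω h
    exact continuous_const.mul (h.sub continuous_const)
  have hN_sq : ∀ n ω, sqIncrements N T n ω = κ ^ 2 * sqIncrements M T n ω := by
    intro n ω
    simp only [sqIncrements, Finset.mul_sum, hNapp]
    exact Finset.sum_congr rfl fun k _ => by ring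
  have hmax := lintegral_exp_dyadicSup_le hN_mart hN_cont (fun ω => by simp [hNapp]) T
    (V := fun ω => κ ^ 2 * V ω) hφ (by
      filter_upwards [hVφ] with ω h
      simpa only [hN_sq] using h.const_mul (κ ^ 2))
  have hright : ∫⁻ ω, ENNReal.ofReal (Real.exp (κ ^ 2 * V ω)) ∂μ ≤
      ∫⁻ ω, EReal.exp (((2 * ε ^ 2 : ℝ) : EReal) * (quadVar M μ T ω : EReal)) ∂μ := by
    refine lintegral_mono_ae ?_
    filter_upwards [quadVar_ae_eq M μ T V hV, hVφ] with ω h1 h2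
    have hV0 : 0 ≤ V ω :=
      ge_of_tendsto' h2 fun n => Finset.sum_nonneg fun _ _ => sq_nonneg _
    rw [h1, EReal.coe_ennreal_ofReal, max_eq_left hV0, ← EReal.coe_mul, EReal.exp_coe]
    gcongr
  have hleft : ∀ᵐ ω ∂μ, ENNReal.ofReal (Real.exp (ε / (T * Real.exp (1 + c * T)) *
      ∫ t in (0 : ℝ)..T, runningSup l t.toNNReal ω)) ≤
      ENNReal.ofReal (Real.exp (ε * l₀)) *
        ENNReal.ofReal (Real.exp (dyadicSup N T ω / 3)) := by
    filter_upwards [hl.ae_continuous, hl_nonneg, hl₀, hM_cont, hM_zero, hlM, hN_cont]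
      with ω hlc hl0 hl00 hMc hM0 hlM hNc
    rw [← ENNReal.ofReal_mul (Real.exp_pos _).le, ← Real.exp_add]
    refine ENNReal.ofReal_le_ofReal (Real.exp_le_exp.2 ?_)
    have hl₀0 : 0 ≤ l₀ := hl00 ▸ hl0 0
    obtain ⟨s, hs, hmax⟩ := (isCompact_Icc (a := (0 : ℝ≥0)) (b := T)).exists_isMaxOn
      ⟨0, le_rfl, zero_le⟩ hMc.continuousOn
    have hm0 : 0 ≤ M s ω := hM0 ▸ hmax (show (0 : ℝ≥0) ∈ Set.Icc 0 T from ⟨le_rfl, zero_le⟩)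
    have hint := integral_runningSup_le hlc hl0 hc (add_nonneg hl₀0 hm0) (T := T) fun t ht => by
      have h1 := hlM 0 t zero_le
      have h2 : M t ω ≤ M s ω := hmax (show t ∈ Set.Icc 0 T from ⟨zero_le, ht⟩)
      rw [NNReal.coe_zero] at h1
      linarith
    have hNs := le_dyadicSup_of_le hNc hs.2
    rw [hNapp, hM0, sub_zero] at hNs
    calc ε / (T * Real.exp (1 + c * T)) * ∫ t in (0 : ℝ)..T, runningSup l t.toNNReal ω
        ≤ ε / (T * Real.exp (1 + c * T)) * (T * Real.exp (c * T) * (l₀ + M s ω)) := by gcongr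
      _ = ε * l₀ / Real.exp 1 + κ * M s ω / 3 := by
        rw [Real.exp_add, hκ]
        field_simp
      _ ≤ ε * l₀ + dyadicSup N T ω / 3 := by
        gcongr
        exact div_le_self (by positivity) (Real.one_le_exp zero_le_one)
  calc ∫⁻ ω, ENNReal.ofReal (Real.exp (ε / (T * Real.exp (1 + c * T)) *
        ∫ t in (0 : ℝ)..T, runningSup l t.toNNReal ω)) ∂μ
      ≤ ∫⁻ ω, ENNReal.ofReal (Real.exp (ε * l₀)) *
          ENNReal.ofReal (Real.exp (dyadicSup N T ω / 3)) ∂μ := lintegral_mono_ae hleft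
    _ = ENNReal.ofReal (Real.exp (ε * l₀)) *
          ∫⁻ ω, ENNReal.ofReal (Real.exp (dyadicSup N T ω / 3)) ∂μ :=
        lintegral_const_mul' _ _ ENNReal.ofReal_ne_top
    _ ≤ ENNReal.ofReal (Real.exp (ε * l₀)) * (ENNReal.ofReal (Real.exp 1) *
          (∫⁻ ω, EReal.exp (((2 * ε ^ 2 : ℝ) : EReal) * (quadVar M μ T ω : EReal)) ∂μ) ^
            (1 / 2 : ℝ)) := by
        gcongr
        exact hmax.trans (by gcongr)
    _ = _ := by
        rw [← mul_assoc, ← ENNReal.ofReal_mul (Real.exp_pos _).le, ← Real.exp_add]
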